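/- For a positive integer $n$ let $\Phi_n(x)=\sum_{i=0}^{\varphi(n)}c_i x^i$ be the $n$-th cyclotomic polynomial and let $A(n)=\max\{|c_i| : 0\le i\le\varphi(n)\}$. For a prime $p$ let $M(p)=\max\{A(pqr) : q,r \text{ primes},\ p<q<r\}$. Then $M(7)=4$; that is, for all primes $7<q<r$ every coefficient of $\Phi_{7qr}$ has absolute value at most $4$, and for some primes $7<q<r$ some coefficient of $\Phi_{7qr}$ has absolute value exactly $4$. Hence, for $p=7$, both Beiter's conjecture ($A(pqr)\le\frac{p+1}{2}$ for all primes $p<q<r$, or in its reformulated version $M(p)=\frac{p+1}{2}$) and the Corrected Beiter conjecture ($M(p)\le\frac23 p$) hold. -/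

import Mathlib

/-- `A(n)`: the largest absolute value of a coefficient `c_i`, `0 ≤ i ≤ φ(n)`, of the
`n`-th cyclotomic polynomial. -/
noncomputable def cyclotomicHeight (n : ℕ) : ℕ :=
  (Finset.range (n.totient + 1)).sup fun i => ((Polynomial.cyclotomic n ℤ).coeff i).natAbs

/-- The set `{A(pqr) ∣ p < q < r}`, where `q` and `r` range over the primes. -/
def ternaryHeights (p : ℕ) : Set ℕ :=
  {a | ∃ q r : ℕ, q.Prime ∧ r.Prime ∧ p < q ∧ q < r ∧ a = cyclotomicHeight (p * q * r)}

/-- `M(p) = m`: the maximum of `{A(pqr) ∣ p < q < r}` exists and equals `m`. -/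
def MaxTernaryHeightEq (p m : ℕ) : Prop :=
  IsGreatest (ternaryHeights p) m

/-- Beiter's conjecture for `p`: `A(pqr) ≤ (p + 1) / 2` for all primes `p < q < r`. -/
def BeiterConjectureAt (p : ℕ) : Prop :=
  ∀ q r : ℕ, q.Prime → r.Prime → p < q → q < r →
    (cyclotomicHeight (p * q * r) : ℚ) ≤ ((p : ℚ) + 1) / 2

/-- Beiter's conjecture for `p` in its reformulated form: `M(p) = (p + 1) / 2`. -/
def BeiterConjectureMaxAt (p : ℕ) : Prop :=
  ∃ m : ℕ, MaxTernaryHeightEq p m ∧ (m : ℚ) = ((p : ℚ) + 1) / 2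

/-- The Corrected Beiter conjecture for `p`: `M(p) ≤ (2 / 3) p`. -/
def CorrectedBeiterConjectureAt (p : ℕ) : Prop :=
  ∃ m : ℕ, MaxTernaryHeightEq p m ∧ (m : ℚ) ≤ 2 / 3 * (p : ℚ)

/-! Let S be the semigroup generated by q and r, and let w(n) be 1 if ⌊n/p⌋ ∈ S and 0 otherwise. The
product formula gives (1 - X^(qr)) Φ_pqr = (1 - X^q)(1 - X^r) ∑ w(n) X^n, so a coefficient of Φ_pqr
is a sum over A of second differences of w at n - Aqr (`cyclotomicCoeff_eq_sum`).

For p = 7, regrouping by residues a modulo 7 turns this into seven terms that depend only on u = q⁻¹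
and v = r⁻¹ modulo 7, on some k < 6 and, for each a, on a cell i < 7 and a truth value
(`exists_cells`). Maximizing the terms independently, a finite check, bounds the sum by 4 except for
a few (u, v, k, sign), where it gives 5. There 5 would force every term to be maximal. But the cells
come from jU mod q for seven consecutive j, and three consecutive values are in arithmetic
progression modulo q, which maximal cells violate (`not_isProgression_of_maximal`). The value 4
occurs for 7·17·23. -/

open Polynomial in
theorem cyclotomic_mul_prime_mul_sub_one {q r : ℕ} (hq : q.Prime) (hr : r.Prime) (hqr : q ≠ r) :
    cyclotomic (q * r) ℤ * ((X ^ q - 1) * (X ^ r - 1)) = (X ^ (q * r) - 1) * (X - 1) := by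
  have : Fact q.Prime := ⟨hq⟩
  have h1 := cyclotomic_prime_mul_X_sub_one ℤ q
  have h2 := cyclotomic_expand_eq_cyclotomic_mul hr
    (fun h => hqr ((Nat.prime_dvd_prime_iff_eq hr hq).1 h).symm) ℤ
  have h3 := congrArg (expand ℤ r) h1
  simp only [map_mul, map_sub, map_pow, expand_X, map_one, h2, ← pow_mul] at h3
  rw [mul_comm r q] at h3
  rw [← h3, ← h1]
  ring

open Polynomial in
theorem cyclotomic_ternary_mul {p q r : ℕ} (hp : p.Prime) (hq : q.Prime) (hr : r.Prime)
    (hpq : p ≠ q) (hpr : p ≠ r) (hqr : q ≠ r) :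
    cyclotomic (p * q * r) ℤ *
        ((1 - X ^ (q * r)) * (1 - X) * ((1 - X ^ (p * q)) * (1 - X ^ (p * r)))) =
      (1 - X ^ (p * q * r)) * (1 - X ^ p) * ((1 - X ^ q) * (1 - X ^ r)) := by
  have h1 := cyclotomic_mul_prime_mul_sub_one hq hr hqr
  have hnd : ¬ p ∣ q * r := by
    rw [hp.dvd_mul, Nat.prime_dvd_prime_iff_eq hp hq, Nat.prime_dvd_prime_iff_eq hp hr]
    tauto
  have h2 := cyclotomic_expand_eq_cyclotomic_mul hp hnd ℤ
  have h3 := congrArg (expand ℤ p) h1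
  simp only [map_mul, map_sub, map_pow, expand_X, map_one, h2, ← pow_mul] at h3
  rw [show p * q * r = q * r * p by ring]
  rw [show p * (q * r) = q * r * p by ring] at h3
  linear_combination (X ^ q - 1) * (X ^ r - 1) * h3 -
    cyclotomic (q * r * p) ℤ * ((X ^ (p * q) - 1) * (X ^ (p * r) - 1)) * h1

/-! ### Power series and the semigroup generated by q and r -/

/-- The power series whose coefficients are the values of `f` at the nonnegative integers. -/
noncomputable def seriesOf (f : ℤ → ℤ) : PowerSeries ℤ := PowerSeries.mk fun n => f n

theorem one_sub_X_pow_mul_seriesOf (k : ℕ) {f : ℤ → ℤ} (hf : ∀ n < 0, f n = 0) :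
    (1 - PowerSeries.X ^ k) * seriesOf f = seriesOf fun n => f n - f (n - k) := by
  ext n
  rw [sub_mul, one_mul, map_sub, PowerSeries.coeff_X_pow_mul']
  simp only [seriesOf, PowerSeries.coeff_mk]
  split_ifs with h
  · rw [Nat.cast_sub h]
  · rw [hf (n - k) (by omega)]

/-- The indicator of the numerical semigroup generated by `q` and `r`, where `u` is an inverse
of `r` modulo `q`. -/
def semigroupIndicator (q r u m : ℤ) : ℤ := if r * (m * u % q) ≤ m then 1 else 0

section semigroup

variable {q r u : ℤ}

theorem semigroupIndicator_of_neg (hq : 0 < q) (hr : 0 < r) {m : ℤ} (hm : m < 0) :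
    semigroupIndicator q r u m = 0 := by
  have h1 := mul_nonneg hr.le (Int.emod_nonneg (m * u) hq.ne')
  rw [semigroupIndicator, if_neg (by omega)]

/-- Replacing m by m - r lowers b = m u mod q by one and both sides of r b ≤ m by r, so the test
changes only when b wraps around from 0 to q - 1, that is, when q ∣ m. -/
theorem semigroupIndicator_sub_right (hq : 0 < q) (hr : 0 < r) (hu : q ∣ r * u - 1) (m : ℤ) :
    semigroupIndicator q r u m - semigroupIndicator q r u (m - r) =
      if q ∣ m ∧ 0 ≤ m ∧ m < q * r then 1 else 0 := by
  obtain ⟨t, ht⟩ := hu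
  have h0 := Int.emod_nonneg (m * u) hq.ne'
  have h1 := Int.emod_lt_of_pos (m * u) hq
  have h2 := Int.emod_add_mul_ediv (m * u) q
  have h3 : (m - r) * u % q = (m * u % q - 1) % q := by
    apply Int.ModEq.symm
    apply (Int.modEq_iff_dvd).2
    exact ⟨m * u / q - t, by linear_combination -h2 - ht⟩
  have h4 : q ∣ m ↔ m * u % q = 0 := by
    refine ⟨fun h => Int.emod_eq_zero_of_dvd (h.mul_right u), fun h => ?_⟩
    have h5 : q ∣ m * u := Int.dvd_of_emod_eq_zero h
    have h6 : m = r * (m * u) - m * q * t := by linear_combination -m * ht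
    rw [h6]
    exact dvd_sub (h5.mul_left r) ⟨m * t, by ring⟩
  simp only [semigroupIndicator, h3, h4]
  generalize m * u % q = b at *
  rcases h0.eq_or_lt with hb | hb
  · subst hb
    have h7 : ((0 : ℤ) - 1) % q = q - 1 := by
      rw [← Int.add_emod_right, Int.emod_eq_of_lt] <;> omega
    rw [h7]
    have h8 : r * (q - 1) ≤ m - r ↔ q * r ≤ m := by constructor <;> intro h <;> linarith
    simp only [mul_zero, h8, true_and]
    have h9 := mul_pos hq hr
    split_ifs <;> omega
  · rw [Int.emod_eq_of_lt (a := b - 1) (by omega) (by omega)]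
    have h8 : r * (b - 1) ≤ m - r ↔ r * b ≤ m := by constructor <;> intro h <;> linarith
    simp only [h8, sub_self, hb.ne', false_and, if_false]

/-- Coefficient form of (1 - X^q)(1 - X^r) ∑_{s ∈ S} X^s = 1 - X^(qr). -/
theorem semigroupIndicator_sub_sub (hq : 0 < q) (hr : 0 < r) (hu : q ∣ r * u - 1) (m : ℤ) :
    semigroupIndicator q r u m - semigroupIndicator q r u (m - r) -
        (semigroupIndicator q r u (m - q) - semigroupIndicator q r u (m - q - r)) =
      (if m = 0 then 1 else 0) - if m = q * r then 1 else 0 := by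
  rw [semigroupIndicator_sub_right hq hr hu, semigroupIndicator_sub_right hq hr hu]
  by_cases h : q ∣ m
  · obtain ⟨t, rfl⟩ := h
    simp only [dvd_mul_right, true_and, mul_eq_zero, hq.ne', false_or,
      mul_lt_mul_iff_right₀ hq, mul_right_inj' hq.ne',
      mul_nonneg_iff_of_pos_left hq, show q * t - q = q * (t - 1) by ring]
    split_ifs <;> omega
  · have h' : ¬ q ∣ m - q := fun h'' => h (dvd_sub_self_right.1 h'')
    rw [if_neg (by tauto), if_neg (by tauto), if_neg, if_neg]
    · rintro rfl; exact h (dvd_mul_right _ _)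
    · rintro rfl; exact h (dvd_zero _)

end semigroup

/-! ### Coefficients as sums of second differences -/

/-- The coefficient of `Φ_n` at an integer index, zero at negative ones. -/
noncomputable def cyclotomicCoeff (n : ℕ) (i : ℤ) : ℤ :=
  if 0 ≤ i then (Polynomial.cyclotomic n ℤ).coeff i.toNat else 0

theorem seriesOf_cyclotomicCoeff (n : ℕ) :
    seriesOf (cyclotomicCoeff n) = (Polynomial.cyclotomic n ℤ : PowerSeries ℤ) := by
  ext i
  simp [seriesOf, cyclotomicCoeff]

theorem cyclotomicCoeff_sub {p q r : ℕ} (hp : p.Prime) (hq : q.Prime) (hr : r.Prime)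
    (hpq : p ≠ q) (hpr : p ≠ r) (hqr : q ≠ r) {u : ℤ} (hu : (q : ℤ) ∣ r * u - 1)
    {w : ℤ → ℤ} (hw : w = fun n => semigroupIndicator q r u (n / p)) (n : ℤ) :
    cyclotomicCoeff (p * q * r) n - cyclotomicCoeff (p * q * r) (n - q * r) =
      w n - w (n - q) - w (n - r) + w (n - q - r) := by
  have hp0 : (0 : ℤ) < p := by exact_mod_cast hp.pos
  have hq0 : (0 : ℤ) < q := by exact_mod_cast hq.pos
  have hr0 : (0 : ℤ) < r := by exact_mod_cast hr.pos
  have hs : ∀ m < 0, semigroupIndicator q r u m = 0 := fun m hm =>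
    semigroupIndicator_of_neg hq0 hr0 hm
  have hw0 : ∀ n < 0, w n = 0 := fun n hn => by
    rw [hw]; exact hs _ (Int.ediv_neg_of_neg_of_pos hn hp0)
  have hc0 : ∀ n < 0, cyclotomicCoeff (p * q * r) n = 0 := fun n hn => if_neg (by omega)
  rcases lt_or_ge n 0 with hn | hn
  · rw [hc0 n hn, hc0 _ (by nlinarith), hw0 _ hn, hw0 _ (by omega), hw0 _ (by omega),
      hw0 _ (by omega)]
    simp
  set σ : ℤ → ℤ := fun n => if (p : ℤ) ∣ n then semigroupIndicator q r u (n / p) else 0 with hσ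
  have hσ0 : ∀ n < 0, σ n = 0 := fun n hn => by
    simp only [hσ]
    rw [hs _ (Int.ediv_neg_of_neg_of_pos hn hp0), ite_self]
  have key1 : (1 - PowerSeries.X ^ (p * q)) * ((1 - PowerSeries.X ^ (p * r)) * seriesOf σ) =
      1 - PowerSeries.X ^ (p * q * r) := by
    rw [one_sub_X_pow_mul_seriesOf _ hσ0, one_sub_X_pow_mul_seriesOf]
    · ext i
      simp only [seriesOf, PowerSeries.coeff_mk, map_sub, PowerSeries.coeff_one,
        PowerSeries.coeff_X_pow]
      by_cases h : (p : ℤ) ∣ i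
      · obtain ⟨t, ht⟩ := h
        have e := semigroupIndicator_sub_sub hq0 hr0 hu t
        have e1 : i = 0 ↔ t = 0 := by
          rw [← Int.natCast_eq_zero, ht, mul_eq_zero]; simp [hp.ne_zero]
        have e2 : i = p * q * r ↔ t = q * r := by
          rw [← Int.natCast_inj, ht]; push_cast
          rw [mul_assoc, mul_right_inj' hp0.ne']
        simp only [hσ, ht, e1, e2, Nat.cast_mul, ← mul_sub, dvd_mul_right, if_true,
          Int.mul_ediv_cancel_left _ hp0.ne']
        exact e
      · have e1 : i ≠ 0 := by rintro rfl; simp at h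
        have e2 : i ≠ p * q * r := by
          rintro rfl; exact h ⟨q * r, by push_cast; ring⟩
        have d1 : ∀ x : ℤ, ∀ y : ℤ, (p : ℤ) ∣ y → ¬ (p : ℤ) ∣ x → ¬ (p : ℤ) ∣ x - y :=
          fun x y hy hx hxy => hx ((dvd_sub_left hy).1 hxy)
        have d2 : (p : ℤ) ∣ ((p * q : ℕ) : ℤ) := ⟨q, by push_cast; ring⟩
        have d3 : (p : ℤ) ∣ ((p * r : ℕ) : ℤ) := ⟨r, by push_cast; ring⟩
        simp only [hσ, e1, e2, if_neg h, if_neg (d1 _ _ d2 h), if_neg (d1 _ _ d3 h),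
          if_neg (d1 _ _ d3 (d1 _ _ d2 h)), if_false, sub_self]
    · intro n hn
      rw [hσ0 _ hn, hσ0 _ (by push_cast; nlinarith), sub_zero]
  -- At n, both sides have the jump of the indicator from n/p - 1 to n/p if p ∣ n, and 0 otherwise.
  have key2 : (1 - PowerSeries.X ^ p) * seriesOf σ = (1 - PowerSeries.X ^ 1) * seriesOf w := by
    rw [one_sub_X_pow_mul_seriesOf _ hσ0, one_sub_X_pow_mul_seriesOf _ hw0]
    congr 1
    funext n
    simp only [hσ, hw, dvd_sub_self_right]
    have e1 := Int.emod_add_mul_ediv n p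
    by_cases h : (p : ℤ) ∣ n
    · obtain ⟨t, rfl⟩ := h
      rw [if_pos (dvd_mul_right _ _), if_pos (dvd_mul_right _ _)]
      congr 2
      rw [show (p : ℤ) * t - p = p * (t - 1) by ring, Int.mul_ediv_cancel_left _ hp0.ne']
      symm
      rw [Int.ediv_eq_iff_of_pos hp0]
      push_cast
      constructor <;> linarith
    · rw [if_neg h, if_neg h, sub_self]
      have h3 : n % p ≠ 0 := fun h' => h (Int.dvd_of_emod_eq_zero h')
      have h4 := Int.emod_nonneg n hp0.ne'
      have h5 := Int.emod_lt_of_pos n hp0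
      have : (n - (1 : ℕ)) / (p : ℤ) = n / p := by
        rw [Int.ediv_eq_iff_of_pos hp0]
        push_cast
        constructor
        · have : 1 ≤ n % p := by omega
          linarith
        · linarith
      rw [this, sub_self]
  have key3 := congrArg (fun f : Polynomial ℤ => (f : PowerSeries ℤ))
    (cyclotomic_ternary_mul hp hq hr hpq hpr hqr)
  simp only [Polynomial.coe_mul, Polynomial.coe_sub, Polynomial.coe_one, Polynomial.coe_pow,
    Polynomial.coe_X, ← seriesOf_cyclotomicCoeff] at key3
  have ne (k : ℕ) (hk : 0 < k) : (1 - PowerSeries.X ^ k : PowerSeries ℤ) ≠ 0 := by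
    intro h
    have := congrArg (PowerSeries.coeff 0) h
    simp [hk.ne'] at this
  have key4 : (1 - PowerSeries.X ^ (q * r)) * seriesOf (cyclotomicCoeff (p * q * r)) =
      (1 - PowerSeries.X ^ r) * ((1 - PowerSeries.X ^ q) * seriesOf w) := by
    apply mul_left_cancel₀ (mul_ne_zero (ne 1 one_pos)
      (mul_ne_zero (ne (p * q) (Nat.mul_pos hp.pos hq.pos))
        (ne (p * r) (Nat.mul_pos hp.pos hr.pos))))
    rw [← key1] at key3
    linear_combination key3 + (1 - PowerSeries.X ^ (p * q)) * (1 - PowerSeries.X ^ (p * r)) *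
      (1 - PowerSeries.X ^ q) * (1 - PowerSeries.X ^ r) * key2
  rw [one_sub_X_pow_mul_seriesOf _ hc0, one_sub_X_pow_mul_seriesOf _ hw0,
    one_sub_X_pow_mul_seriesOf] at key4
  · have := congrArg (PowerSeries.coeff n.toNat) key4
    simp only [seriesOf, PowerSeries.coeff_mk, Int.toNat_of_nonneg hn] at this
    push_cast at this
    rw [this, show n - (q : ℤ) - r = n - r - q by ring]
    ring
  · intro n hn
    rw [hw0 _ hn, hw0 _ (by omega), sub_zero]

theorem cyclotomicCoeff_eq_sum {p q r : ℕ} (hp : p.Prime) (hq : q.Prime) (hr : r.Prime)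
    (hpq : p ≠ q) (hpr : p ≠ r) (hqr : q ≠ r) {u : ℤ} (hu : (q : ℤ) ∣ r * u - 1)
    {w : ℤ → ℤ} (hw : w = fun n => semigroupIndicator q r u (n / p)) (K : ℕ) (n : ℤ)
    (hn : n < K * (q * r)) :
    cyclotomicCoeff (p * q * r) n = ∑ a ∈ Finset.range K,
      (w (n - a * (q * r)) - w (n - a * (q * r) - q) - w (n - a * (q * r) - r) +
        w (n - a * (q * r) - q - r)) := by
  induction K generalizing n with
  | zero =>
    simp at hn
    simp [cyclotomicCoeff, not_le.2 hn]
  | succ K ih =>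
    have h1 := cyclotomicCoeff_sub hp hq hr hpq hpr hqr hu hw n
    have h2 := ih (n - q * r) (by push_cast at hn; linarith)
    rw [Finset.sum_range_succ', sub_eq_iff_eq_add'.1 h1, h2]
    congr 1
    · refine Finset.sum_congr rfl fun a _ => ?_
      push_cast
      rw [show n - (q * r : ℤ) - a * (q * r) = n - (a + 1) * (q * r) by ring]
    · simp

/-! ### Finite checks modulo 7 -/

/-- Whether `(i + A) q + e ≤ k q + f` holds, for `0 ≤ e, f < q` and `g` the truth value
of `e ≤ f`. -/
def cellIndicator (k i A : ℕ) (g : Bool) : ℤ :=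
  bif Nat.blt (i + A) k || (Nat.beq (i + A) k && g) then 1 else 0

/-- The contribution of a residue `a` modulo `7` to a coefficient. -/
def residueTerm (u v k a i : ℕ) (g : Bool) : ℤ :=
  cellIndicator k i a g - cellIndicator k i ((a + (7 - v)) % 7) g -
    cellIndicator k ((i + u) % 7) ((a + (7 - u)) % 7) g +
    cellIndicator k ((i + u) % 7) ((a + (14 - u - v)) % 7) g

/-- The largest of `σ * residueTerm u v k a i g` over `i < m` and `g`, or `-7` if that is larger. -/
def residueMax (σ : ℤ) (u v k a : ℕ) : ℕ → ℤ
  | 0 => -7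
  | m + 1 => max (residueMax σ u v k a m)
      (max (σ * residueTerm u v k a m true) (σ * residueTerm u v k a m false))

theorem residueTerm_le_residueMax (σ : ℤ) (u v k a : ℕ) {i m : ℕ} (hi : i < m) (g : Bool) :
    σ * residueTerm u v k a i g ≤ residueMax σ u v k a m := by
  induction m with
  | zero => omega
  | succ m ih =>
    rw [residueMax]
    rcases Nat.lt_succ_iff_lt_or_eq.1 hi with h | rfl
    · exact (ih h).trans (le_max_left _ _)
    · refine le_trans ?_ (le_max_right _ _)
      cases g
      · exact le_max_right _ _
      · exact le_max_left _ _

/-- The cases in which the sum of the maximal contributions of the residues is `5`. -/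
def IsExceptional (σ : ℤ) (u v k : ℕ) : Prop :=
  (u = 2 ∨ u = 5) ∧ (v = 2 ∨ v = 5) ∧ (k = 2 ∨ k = 3) ∧ σ = if u = v then 1 else -1

instance (σ : ℤ) (u v k : ℕ) : Decidable (IsExceptional σ u v k) := by
  unfold IsExceptional; infer_instance

theorem sum_residueMax_le_four : ∀ σ ∈ ({1, -1} : Finset ℤ), ∀ u ∈ Finset.Icc 1 6,
    ∀ v ∈ Finset.Icc 1 6, ∀ k ∈ Finset.range 6, ¬ IsExceptional σ u v k →
      ∑ a ∈ Finset.range 7, residueMax σ u v k a 7 ≤ 4 := by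
  decide +kernel

theorem sum_residueMax_le_five : ∀ σ ∈ ({1, -1} : Finset ℤ), ∀ u ∈ Finset.Icc 1 6,
    ∀ v ∈ Finset.Icc 1 6, ∀ k ∈ Finset.range 6, IsExceptional σ u v k →
      ∑ a ∈ Finset.range 7, residueMax σ u v k a 7 ≤ 5 := by
  decide +kernel

/-- A condition on the cells `i` and truth values `g` of three numbers `7 b = i q + e` whose second
difference vanishes modulo `7 q`. -/
def IsProgression (i₁ i₂ i₃ : ℕ) (g₁ g₂ g₃ : Bool) : Prop :=
  ((i₁ + i₃ + 14 - 2 * i₂) % 7 = 6 ∧ (g₁ → g₂) ∧ (g₃ → g₂)) ∨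
  ((i₁ + i₃ + 14 - 2 * i₂) % 7 = 1 ∧ (g₂ → g₁ ∧ g₃)) ∨
  ((i₁ + i₃ + 14 - 2 * i₂) % 7 = 0 ∧ (g₁ ∧ g₃ → g₂) ∧ (g₂ → g₁ ∨ g₃))

instance (i₁ i₂ i₃ : ℕ) (g₁ g₂ g₃ : Bool) : Decidable (IsProgression i₁ i₂ i₃ g₁ g₂ g₃) := by
  unfold IsProgression; infer_instance

/-- A residue `c` modulo `7` such that in an exceptional case the contributions of the classes
`c - 1, c, c + 1`, or of the classes `c + 1, c + 2, c + 3`, cannot all be maximal. -/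
def center (u v : ℕ) : ℕ := if u ≠ v then 0 else if u = 2 then 2 else 1

/-- The class a = c u v is the one with a q r ≡ c modulo 7; c + 6 stands for c - 1. -/
theorem not_isProgression_of_maximal : ∀ σ ∈ ({1, -1} : Finset ℤ), ∀ u ∈ ({2, 5} : Finset ℕ),
    ∀ v ∈ ({2, 5} : Finset ℕ), ∀ k ∈ ({2, 3} : Finset ℕ), IsExceptional σ u v k →
    ∀ c ∈ ({center u v, center u v + 2} : Finset ℕ),
    ∀ i₁ ∈ Finset.range 7, ∀ g₁,
      σ * residueTerm u v k ((c + 6) * (u * v) % 7) i₁ g₁ =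
        residueMax σ u v k ((c + 6) * (u * v) % 7) 7 →
    ∀ i₂ ∈ Finset.range 7, ∀ g₂,
      σ * residueTerm u v k (c * (u * v) % 7) i₂ g₂ = residueMax σ u v k (c * (u * v) % 7) 7 →
    ∀ i₃ ∈ Finset.range 7, ∀ g₃,
      σ * residueTerm u v k ((c + 1) * (u * v) % 7) i₃ g₃ =
        residueMax σ u v k ((c + 1) * (u * v) % 7) 7 →
    ¬ IsProgression i₁ i₂ i₃ g₁ g₂ g₃ := by
  decide +kernel

/-! ### Reduction of a coefficient to cells -/

/-- The integer congruent to `z` modulo `7` among the seven integers ending in `n`. -/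
def windowRep (n z : ℤ) : ℤ := n - (n - z) % 7

theorem semigroupIndicator_eq_cellIndicator {q r U u v n f : ℤ} {k i A a : ℕ} {e : ℤ} {ε δ : ℤ}
    (hq : 7 < q) (hr : 0 < r)
    (hU : q ∣ r * (7 * U) - 1) (hu : 7 ∣ q * u - 1) (hv : 7 ∣ r * v - 1)
    (hu0 : 0 < u) (hu7 : u < 7) (hε : ε = 0 ∨ ε = 1) (hδ : δ = 0 ∨ δ = 1)
    (hf0 : 0 ≤ f) (hfq : f < q) (hM : n / r = k * q + f)
    (he0 : 0 ≤ e) (heq : e < q)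
    (hb : 7 * (windowRep n (a * (q * r)) * U % q) = i * q + e)
    (ha : 7 ∣ (a : ℤ) - A - ε * v - δ * u) :
    semigroupIndicator q r (7 * U) ((n - A * (q * r) - ε * q - δ * r) / 7) =
      cellIndicator k ((i + δ.toNat * u.toNat) % 7) A (decide (e ≤ f)) := by
  have hq0 : 0 < q := by omega
  set j := windowRep n (a * (q * r)) with hj
  set t := (n - a * (q * r)) % 7 with ht
  have ht0 : 0 ≤ t := Int.emod_nonneg _ (by norm_num)
  have ht7 : t < 7 := Int.emod_lt_of_pos _ (by norm_num)
  have hjt : j = n - t := rfl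
  set m := (n - A * (q * r) - ε * q - δ * r) / 7 with hm
  have hm7 : 7 * m = j - A * (q * r) - ε * q - δ * r := by
    have h1 : (7 : ℤ) ∣ j - A * (q * r) - ε * q - δ * r := by
      have h2 : (7 : ℤ) ∣ n - a * (q * r) - t := Int.dvd_self_sub_emod
      obtain ⟨x, hx⟩ := h2
      obtain ⟨y, hy⟩ := ha
      obtain ⟨z, hz⟩ := hu
      obtain ⟨s, hs⟩ := hv
      exact ⟨x + y * q * r + ε * q * s + δ * r * z, by
        rw [hjt]; linear_combination hx + q * r * hy + ε * q * hs + δ * r * hz⟩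
    omega
  set b := j * U % q with hbdef
  have hb0 : 0 ≤ b := Int.emod_nonneg _ hq0.ne'
  have hbq : b < q := Int.emod_lt_of_pos _ hq0
  set b' := m * (7 * U) % q with hb'def
  have hb'0 : 0 ≤ b' := Int.emod_nonneg _ hq0.ne'
  have hb'q : b' < q := Int.emod_lt_of_pos _ hq0
  have hbj : q ∣ 7 * r * b - j := by
    obtain ⟨x, hx⟩ := hU
    have h1 := Int.emod_add_mul_ediv (j * U) q
    exact ⟨j * x - 7 * r * (j * U / q), by linear_combination 7 * r * h1 + j * hx⟩
  have hb'm : q ∣ r * b' - m := by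
    obtain ⟨x, hx⟩ := hU
    have h1 := Int.emod_add_mul_ediv (m * (7 * U)) q
    exact ⟨m * x - r * (m * (7 * U) / q), by linear_combination r * h1 + m * hx⟩
  have hqr : IsCoprime q r := by
    obtain ⟨x, hx⟩ := hU
    exact ⟨-x, 7 * U, by linear_combination hx⟩
  -- Modulo q, 7m ≡ j - δr and 7rU ≡ 1, hence 7b' ≡ 7b - δ. Modulo 7, κq ≡ δ, hence κ ≡ δu; the
  -- bounds on i + κ then determine it.
  obtain ⟨κ, hκ⟩ : q ∣ 7 * b' - 7 * b + δ := by
    refine hqr.dvd_of_dvd_mul_left ?_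
    obtain ⟨x, hx⟩ := hbj
    obtain ⟨y, hy⟩ := hb'm
    exact ⟨7 * y - x - A * r - ε, by linear_combination 7 * hy - hx + hm7⟩
  obtain ⟨l, hl⟩ : (7 : ℤ) ∣ κ - δ * u := by
    obtain ⟨z, hz⟩ := hu
    refine ⟨u * (b' - b) - κ * z, ?_⟩
    linear_combination -u * hκ - κ * hz
  have hcell : 0 ≤ i + κ ∧ i + κ < 7 := by
    have h1 : (i + κ) * q = 7 * b' - e + δ := by linear_combination -hκ - hb
    constructor
    · by_contra h
      have h2 : (i + κ) * q ≤ -1 * q := mul_le_mul_of_nonneg_right (by omega) hq0.le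
      rcases hδ with rfl | rfl <;> linarith
    · by_contra h
      have h2 : 7 * q ≤ (i + κ) * q := mul_le_mul_of_nonneg_right (by omega) hq0.le
      rcases hδ with rfl | rfl <;> linarith
  have hcell' : (((i + δ.toNat * u.toNat) % 7 : ℕ) : ℤ) = i + κ := by
    rcases hδ with rfl | rfl
    · simp at hl ⊢; omega
    · simp at hl ⊢; omega
  have hY : r * b' ≤ m ↔ 7 * b + (κ + A) * q ≤ n / r := by
    rw [Int.le_ediv_iff_mul_le hr]
    obtain ⟨y, hy⟩ : 7 * q ∣ 7 * (m - r * b') := mul_dvd_mul_left 7 (dvd_sub_comm.1 hb'm)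
    have hZ : n - (7 * b + (κ + A) * q) * r = 7 * (m - r * b') + t + ε * q := by
      linear_combination -hjt - hm7 + r * hκ
    constructor
    · intro h
      have : 0 ≤ ε * q := by rcases hε with rfl | rfl <;> omega
      linarith
    -- If r b' > m, the multiple 7(m - r b') of 7q is at most -7q, which t + εq ≤ 6 + q cannot
    -- compensate.
    · intro h
      by_contra hlt
      have h1 : y < 0 := by
        by_contra hy0
        have := mul_nonneg (by omega : (0 : ℤ) ≤ 7 * q) (not_lt.1 hy0)
        linarith
      have h2 : 7 * q * y ≤ - (7 * q) := by nlinarith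
      rcases hε with rfl | rfl <;> linarith
  have hcomp : 7 * b + (κ + A) * q ≤ n / r ↔
      (i + κ + A < k ∨ (i + κ + A = k ∧ e ≤ f)) := by
    rw [hM, hb]
    rcases lt_trichotomy (i + κ + A) (k : ℤ) with h | h | h
    · simp only [h, true_or, iff_true]
      nlinarith
    · simp only [h, lt_irrefl, false_or, true_and]
      have : i * q + e + (κ + A) * q = k * q + e := by rw [← h]; ring
      rw [this]; omega
    · simp only [h.not_gt, h.ne', false_and, or_self, iff_false, not_le]
      nlinarith
  rw [semigroupIndicator, cellIndicator]
  generalize (i + δ.toNat * u.toNat) % 7 = c at *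
  rw [← hb'def]
  simp only [hY, hcomp, Bool.cond_eq_ite, Bool.or_eq_true, Bool.and_eq_true, Nat.beq_eq,
    Nat.blt_eq, decide_eq_true_eq]
  rw [← hcell']
  norm_cast

theorem windowRep_congr {n y z : ℤ} (h : 7 ∣ y - z) : windowRep n y = windowRep n z := by
  unfold windowRep; omega

/-- Here e₁ + e₃ - 2e₂ is a multiple of q strictly between -2q and 2q; each of the values q, -q, 0
fixes i₁ + i₃ - 2i₂ modulo 7 and constrains the order of the e's. -/
theorem isProgression_of_dvd {q b₁ b₂ b₃ e₁ e₂ e₃ f : ℤ} {i₁ i₂ i₃ : ℕ}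
    (h : q ∣ b₁ + b₃ - 2 * b₂) (h₁ : 7 * b₁ = i₁ * q + e₁) (h₂ : 7 * b₂ = i₂ * q + e₂)
    (h₃ : 7 * b₃ = i₃ * q + e₃) (he₁ : 0 ≤ e₁) (he₁' : e₁ < q) (he₂ : 0 ≤ e₂) (he₂' : e₂ < q)
    (he₃ : 0 ≤ e₃) (he₃' : e₃ < q) (hi₂ : i₂ < 7) :
    IsProgression i₁ i₂ i₃ (decide (e₁ ≤ f)) (decide (e₂ ≤ f)) (decide (e₃ ≤ f)) := by
  obtain ⟨t, ht⟩ := h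
  have hc : e₁ + e₃ - 2 * e₂ = (7 * t - i₁ - i₃ + 2 * i₂) * q := by
    linear_combination 7 * ht - h₁ - h₃ + 2 * h₂
  have hq : 0 < q := by omega
  have hc1 : 7 * t - i₁ - i₃ + 2 * i₂ < 2 := by
    by_contra hlt
    have := mul_le_mul_of_nonneg_right (not_lt.1 hlt) hq.le
    linarith
  have hc2 : -2 < 7 * t - i₁ - i₃ + 2 * i₂ := by
    by_contra hlt
    have := mul_le_mul_of_nonneg_right (not_lt.1 hlt) hq.le
    linarith
  simp only [IsProgression, decide_eq_true_eq]
  obtain h | h | h : 7 * t - i₁ - i₃ + 2 * i₂ = 1 ∨ 7 * t - i₁ - i₃ + 2 * i₂ = -1 ∨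
      7 * t - i₁ - i₃ + 2 * i₂ = 0 := by omega
  · rw [h] at hc
    exact Or.inl ⟨by omega, by omega, by omega⟩
  · rw [h] at hc
    exact Or.inr (Or.inl ⟨by omega, by omega⟩)
  · rw [h] at hc
    exact Or.inr (Or.inr ⟨by omega, by omega, by omega⟩)

theorem sum_range_seven_shift (F : ℕ → ℕ → ℤ) (s : ℕ) (hs : s ≤ 14) :
    ∑ A ∈ Finset.range 7, F A ((A + s) % 7) =
      ∑ a ∈ Finset.range 7, F ((a + (14 - s)) % 7) a := by
  refine Finset.sum_nbij' (fun A => (A + s) % 7) (fun a => (a + (14 - s)) % 7) ?_ ?_ ?_ ?_ ?_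
  · intro A hA; simp only [Finset.mem_range] at *; omega
  · intro A hA; simp only [Finset.mem_range] at *; omega
  · intro A hA; simp only [Finset.mem_range] at *; omega
  · intro A hA; simp only [Finset.mem_range] at *; omega
  · intro A hA
    simp only [Finset.mem_range] at *
    congr 1; omega

theorem sum_cellIndicator_eq_sum_residueTerm (k : ℕ) (i : ℕ → ℕ) (g : ℕ → Bool) {u v : ℕ}
    (hu : u ≤ 7) (hv : v ≤ 7) :
    ∑ A ∈ Finset.range 7, (cellIndicator k (i (A % 7)) A (g (A % 7)) -
      cellIndicator k (i ((A + v) % 7)) A (g ((A + v) % 7)) -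
      cellIndicator k ((i ((A + u) % 7) + u) % 7) A (g ((A + u) % 7)) +
      cellIndicator k ((i ((A + (u + v)) % 7) + u) % 7) A (g ((A + (u + v)) % 7))) =
    ∑ a ∈ Finset.range 7, residueTerm u v k a (i a) (g a) := by
  rw [Finset.sum_add_distrib, Finset.sum_sub_distrib, Finset.sum_sub_distrib,
    sum_range_seven_shift (fun A a => cellIndicator k (i a) A (g a)) v (by omega),
    sum_range_seven_shift (fun A a => cellIndicator k ((i a + u) % 7) A (g a)) u (by omega),
    sum_range_seven_shift (fun A a => cellIndicator k ((i a + u) % 7) A (g a)) (u + v) (by omega),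
    ← Finset.sum_sub_distrib, ← Finset.sum_sub_distrib, ← Finset.sum_add_distrib]
  refine Finset.sum_congr rfl fun a ha => ?_
  rw [residueTerm, Nat.mod_eq_of_lt (Finset.mem_range.1 ha),
    show (a + (14 - v)) % 7 = (a + (7 - v)) % 7 by omega,
    show (a + (14 - u)) % 7 = (a + (7 - u)) % 7 by omega,
    show 14 - (u + v) = 14 - u - v by omega]

theorem exists_cells {q r : ℕ} (hq : q.Prime) (hr : r.Prime) (hq7 : 7 < q) (hqr : q < r)
    {u v : ℕ} (hu : (7 : ℤ) ∣ q * u - 1) (hv : (7 : ℤ) ∣ r * v - 1)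
    (hu0 : 0 < u) (hu7 : u < 7) (hv7 : v < 7) {n : ℤ} (hn0 : 0 ≤ n)
    (hn : n < 6 * (q * r)) :
    ∃ k < 6, ∃ (i : ℕ → ℕ) (g : ℕ → Bool), (∀ a, i a < 7) ∧
      cyclotomicCoeff (7 * q * r) n =
        ∑ a ∈ Finset.range 7, residueTerm u v k a (i a) (g a) ∧
      ∀ ρ : ℕ, 0 < (n - ρ) % 7 → (n - ρ) % 7 < 6 →
        IsProgression (i ((ρ + 6) * (u * v) % 7)) (i (ρ * (u * v) % 7))
          (i ((ρ + 1) * (u * v) % 7)) (g ((ρ + 6) * (u * v) % 7)) (g (ρ * (u * v) % 7))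
          (g ((ρ + 1) * (u * v) % 7)) := by
  have hq0 : (0 : ℤ) < q := by exact_mod_cast hq.pos
  have hr0 : (0 : ℤ) < r := by exact_mod_cast hr.pos
  obtain ⟨U, hU⟩ : ∃ U : ℤ, (q : ℤ) ∣ r * (7 * U) - 1 := by
    have h1 : Nat.Coprime (7 * r) q := by
      apply Nat.Coprime.mul_left
      · exact (Nat.coprime_primes (by norm_num) hq).2 (by omega)
      · exact (Nat.coprime_primes hr hq).2 (by omega)
    obtain ⟨x, y, hxy⟩ := Nat.isCoprime_iff_coprime.2 h1
    push_cast at hxy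
    exact ⟨x, -y, by linear_combination hxy⟩
  set f := n / r % q with hf
  have hf0 : 0 ≤ f := Int.emod_nonneg _ hq0.ne'
  have hfq : f < q := Int.emod_lt_of_pos _ hq0
  have hM0 : 0 ≤ n / r := Int.ediv_nonneg hn0 hr0.le
  have hk0 : 0 ≤ n / r / q := Int.ediv_nonneg hM0 hq0.le
  obtain ⟨k, hk⟩ := Int.eq_ofNat_of_zero_le hk0
  have hM : n / r = k * q + f := by rw [hf, ← hk]; linarith [Int.emod_add_mul_ediv (n / r) q]
  have hk6 : k < 6 := by
    have : n / r / q < 6 := by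
      rw [Int.ediv_lt_iff_lt_mul hq0, Int.ediv_lt_iff_lt_mul hr0]; linarith
    omega
  set b : ℤ → ℤ := fun j => j * U % q with hb
  have hb0 (j) : 0 ≤ b j := Int.emod_nonneg _ hq0.ne'
  have hbq (j) : b j < q := Int.emod_lt_of_pos _ hq0
  set J : ℕ → ℤ := fun a => windowRep n (a * (q * r)) with hJ
  set i : ℕ → ℕ := fun a => (7 * b (J a) / q).toNat with hi
  set e : ℕ → ℤ := fun a => 7 * b (J a) % q with he
  have he0 (a) : 0 ≤ e a := Int.emod_nonneg _ hq0.ne'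
  have heq (a) : e a < q := Int.emod_lt_of_pos _ hq0
  have hi7 (a) : i a < 7 := by
    have : 7 * b (J a) / q < 7 := by
      rw [Int.ediv_lt_iff_lt_mul hq0]; linarith [hbq (J a)]
    simp only [hi]; omega
  have hie (a) : 7 * b (J a) = i a * q + e a := by
    have h1 : 0 ≤ 7 * b (J a) / q := Int.ediv_nonneg (by linarith [hb0 (J a)]) hq0.le
    simp only [hi, he, Int.toNat_of_nonneg h1]
    linarith [Int.emod_add_mul_ediv (7 * b (J a)) q]
  refine ⟨k, hk6, i, fun a => decide (e a ≤ f), hi7, ?_, ?_⟩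
  -- Six terms would suffice for n < 6qr; with seven, A runs over all residues modulo 7.
  · rw [cyclotomicCoeff_eq_sum (by norm_num) hq hr (by omega) (by omega) (by omega) hU rfl 7 n
      (by push_cast; nlinarith [mul_pos hq0 hr0])]
    have key (A : ℕ) (ε δ s : ℕ) (hε : ε = 0 ∨ ε = 1) (hδ : δ = 0 ∨ δ = 1)
        (hs : s = ε * v + δ * u) :
        semigroupIndicator q r (7 * U) ((n - A * (q * r) - ε * q - δ * r) / 7) =
          cellIndicator k ((i ((A + s) % 7) + δ * u) % 7) A
            (decide (e ((A + s) % 7) ≤ f)) := by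
      have := semigroupIndicator_eq_cellIndicator (q := q) (r := r) (U := U) (u := u) (v := v)
        (n := n) (f := f) (k := k) (i := i ((A + s) % 7)) (A := A) (a := (A + s) % 7)
        (e := e ((A + s) % 7)) (ε := ε) (δ := δ) (by exact_mod_cast hq7) hr0 hU hu hv
        (by omega) (by omega) (by omega) (by omega) hf0 hfq hM (he0 _) (heq _) (hie _) (by
          have : ((ε * v + δ * u : ℕ) : ℤ) = ε * v + δ * u := by push_cast; rfl
          rw [← hs] at this
          push_cast
          omega)
      simpa using this
    have h1 := fun A => key A 0 0 0 (by simp) (by simp) (by simp)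
    have h2 := fun A => key A 1 0 v (by simp) (by simp) (by simp)
    have h3 := fun A => key A 0 1 u (by simp) (by simp) (by simp)
    have h4 := fun A => key A 1 1 (u + v) (by simp) (by simp) (by simp [add_comm])
    simp only [Nat.cast_zero, Nat.cast_one, zero_mul, one_mul, sub_zero, add_zero] at h1 h2 h3 h4
    have g1 (a : ℕ) : i a % 7 = i a := Nat.mod_eq_of_lt (hi7 a)
    simp only [g1] at h1 h2
    simp only [Nat.cast_ofNat, h1, h2, h3, h4]
    exact sum_cellIndicator_eq_sum_residueTerm k i (fun a => decide (e a ≤ f)) hu7.le hv7.le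
  · intro ρ h0 h6
    have hJρ (ρ : ℕ) : J (ρ * (u * v) % 7) = n - (n - ρ) % 7 := by
      simp only [hJ]
      rw [windowRep_congr (z := ρ), windowRep]
      obtain ⟨x, hx⟩ := hu
      obtain ⟨y, hy⟩ := hv
      have h1 := Int.emod_add_mul_ediv (ρ * (u * v)) 7
      exact ⟨ρ * (x * (r * v) + y) - q * r * ((ρ * (u * v) : ℤ) / 7), by
        push_cast
        linear_combination q * r * h1 + ρ * r * v * hx + ρ * hy⟩
    refine isProgression_of_dvd ?_ (hie _) (hie _) (hie _) (he0 _) (heq _) (he0 _) (heq _)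
      (he0 _) (heq _) (hi7 _)
    rw [hJρ, hJρ, hJρ]
    -- As ρ is not the class of an endpoint of the window, its neighbours are represented by j - 1
    -- and j + 1.
    have h1 : n - (n - ((ρ + 6 : ℕ) : ℤ)) % 7 = n - (n - ρ) % 7 - 1 := by push_cast; omega
    have h2 : n - (n - ((ρ + 1 : ℕ) : ℤ)) % 7 = n - (n - ρ) % 7 + 1 := by push_cast; omega
    rw [h1, h2]
    generalize n - (n - ρ) % 7 = j
    have e1 := Int.emod_add_mul_ediv (j * U) q
    have e2 := Int.emod_add_mul_ediv ((j - 1) * U) q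
    have e3 := Int.emod_add_mul_ediv ((j + 1) * U) q
    exact ⟨2 * (j * U / q) - (j - 1) * U / q - (j + 1) * U / q, by
      simp only [hb]; linear_combination e2 + e3 - 2 * e1⟩

/-! ### The upper bound -/

theorem exists_inverse_mod_seven {q : ℕ} (hq : q.Prime) (hq7 : q ≠ 7) :
    ∃ u : ℕ, 0 < u ∧ u < 7 ∧ (7 : ℤ) ∣ q * u - 1 := by
  have h : q % 7 ≠ 0 := fun h =>
    hq7 ((Nat.prime_dvd_prime_iff_eq (by norm_num) hq).1 (Nat.dvd_of_mod_eq_zero h)).symm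
  have h7 : q % 7 < 7 := Nat.mod_lt _ (by norm_num)
  have key : ∀ x ∈ Finset.range 7, x ≠ 0 → ∃ u ∈ Finset.Icc 1 6, x * u % 7 = 1 := by decide
  obtain ⟨u, hu, hu1⟩ := key _ (Finset.mem_range.2 h7) h
  rw [Finset.mem_Icc] at hu
  refine ⟨u, by omega, by omega, ?_⟩
  rw [Nat.mod_mul_mod] at hu1
  zify at hu1
  omega

theorem mul_cyclotomicCoeff_le_four {q r : ℕ} (hq : q.Prime) (hr : r.Prime) (hq7 : 7 < q)
    (hqr : q < r) {n : ℤ} (hn0 : 0 ≤ n) (hn : n < 6 * (q * r)) {σ : ℤ} (hσ : σ = 1 ∨ σ = -1) :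
    σ * cyclotomicCoeff (7 * q * r) n ≤ 4 := by
  obtain ⟨u, hu0, hu7, hu⟩ := exists_inverse_mod_seven hq (by omega)
  obtain ⟨v, hv0, hv7, hv⟩ := exists_inverse_mod_seven hr (by omega)
  obtain ⟨k, hk, i, g, hi, hsum, hprog⟩ := exists_cells hq hr hq7 hqr hu hv hu0 hu7 hv7 hn0 hn
  have hσ' : σ ∈ ({1, -1} : Finset ℤ) := by simpa using hσ
  have hu' : u ∈ Finset.Icc 1 6 := Finset.mem_Icc.2 ⟨hu0, by omega⟩
  have hv' : v ∈ Finset.Icc 1 6 := Finset.mem_Icc.2 ⟨hv0, by omega⟩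
  have hk' : k ∈ Finset.range 6 := Finset.mem_range.2 hk
  rw [hsum, Finset.mul_sum]
  have hle : ∀ a ∈ Finset.range 7,
      σ * residueTerm u v k a (i a) (g a) ≤ residueMax σ u v k a 7 :=
    fun a _ => residueTerm_le_residueMax σ u v k a (hi a) (g a)
  have hle' := Finset.sum_le_sum hle
  by_cases hex : IsExceptional σ u v k
  · have h5 := sum_residueMax_le_five σ hσ' u hu' v hv' k hk' hex
    by_contra hlt
    have heq := (Finset.sum_eq_sum_iff_of_le hle).1 (by omega)
    have hmax (x : ℕ) := heq (x % 7) (Finset.mem_range.2 (Nat.mod_lt x (by norm_num)))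
    -- If the first center is at an end of the window, the second, two classes further, is in its
    -- interior.
    obtain ⟨c, hc, h0, h6⟩ : ∃ c ∈ ({center u v, center u v + 2} : Finset ℕ),
        0 < (n - c) % 7 ∧ (n - c) % 7 < 6 := by
      by_cases h : 0 < (n - center u v) % 7 ∧ (n - center u v) % 7 < 6
      · exact ⟨_, Finset.mem_insert_self _ _, h⟩
      · refine ⟨center u v + 2, by simp, ?_⟩
        push_cast
        omega
    obtain ⟨hu2, hv2, hk2, -⟩ := id hex
    exact not_isProgression_of_maximal σ hσ' u (by simpa using hu2) v (by simpa using hv2) k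
      (by simpa using hk2) hex c hc _ (Finset.mem_range.2 (hi _)) _ (hmax _)
      _ (Finset.mem_range.2 (hi _)) _ (hmax _) _ (Finset.mem_range.2 (hi _)) _ (hmax _)
      (hprog c h0 h6)
  · exact hle'.trans (sum_residueMax_le_four σ hσ' u hu' v hv' k hk' hex)

theorem cyclotomicHeight_seven_mul_le {q r : ℕ} (hq : q.Prime) (hr : r.Prime) (hq7 : 7 < q)
    (hqr : q < r) : cyclotomicHeight (7 * q * r) ≤ 4 := by
  refine Finset.sup_le fun i hi => ?_
  have h7 : Nat.Prime 7 := by norm_num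
  have htot : (7 * q * r).totient = 6 * (q - 1) * (r - 1) := by
    rw [Nat.totient_mul, Nat.totient_mul, Nat.totient_prime h7, Nat.totient_prime hq,
      Nat.totient_prime hr]
    · exact (Nat.coprime_primes h7 hq).2 (by omega)
    · exact Nat.Coprime.mul_left ((Nat.coprime_primes h7 hr).2 (by omega))
        ((Nat.coprime_primes hq hr).2 (by omega))
  rw [Finset.mem_range, htot] at hi
  have hlt : i < 6 * (q * r) := by
    have h1 : (q - 1) * (r - 1) < q * r :=
      Nat.mul_lt_mul'' (by omega) (by omega)
    rw [mul_assoc] at hi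
    omega
  have hlt' : (i : ℤ) < 6 * (q * r) := by exact_mod_cast hlt
  have h1 := mul_cyclotomicCoeff_le_four hq hr hq7 hqr (Int.natCast_nonneg i) hlt' (.inl rfl)
  have h2 := mul_cyclotomicCoeff_le_four hq hr hq7 hqr (Int.natCast_nonneg i) hlt' (.inr rfl)
  have h3 : cyclotomicCoeff (7 * q * r) i = (Polynomial.cyclotomic (7 * q * r) ℤ).coeff i := by
    simp [cyclotomicCoeff]
  rw [h3] at h1 h2
  omega

/-! ### The value 4 is attained -/

theorem coeff_cyclotomic_seven_mul_seventeen_mul_twentythree :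
    (Polynomial.cyclotomic (7 * 17 * 23) ℤ).coeff 875 = 4 := by
  -- 23·3 = 69 ≡ 1 modulo 17, and three terms suffice since 875 < 3·17·23.
  have h := cyclotomicCoeff_eq_sum (p := 7) (q := 17) (r := 23) (u := 3) (by norm_num)
    (by norm_num) (by norm_num) (by norm_num) (by norm_num) (by norm_num) (by norm_num) rfl 3 875
    (by norm_num)
  have h' : cyclotomicCoeff (7 * 17 * 23) 875 =
      (Polynomial.cyclotomic (7 * 17 * 23) ℤ).coeff 875 := if_pos (by norm_num)
  rw [← h', h]
  decide

theorem maxTernaryHeightEq_seven_four : MaxTernaryHeightEq 7 4 := by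
  refine ⟨⟨17, 23, by norm_num, by norm_num, by norm_num, by norm_num, ?_⟩, ?_⟩
  · refine le_antisymm ?_
      (cyclotomicHeight_seven_mul_le (by norm_num) (by norm_num) (by norm_num) (by norm_num))
    have htot : (7 * 17 * 23).totient = 2112 := by
      rw [Nat.totient_mul (by norm_num), Nat.totient_mul (by norm_num),
        Nat.totient_prime (by norm_num), Nat.totient_prime (by norm_num),
        Nat.totient_prime (by norm_num)]
    have h := Finset.le_sup
      (f := fun i => ((Polynomial.cyclotomic (7 * 17 * 23) ℤ).coeff i).natAbs)
      (Finset.mem_range.2 (by rw [htot]; norm_num :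
        875 < (7 * 17 * 23).totient + 1))
    simp only [coeff_cyclotomic_seven_mul_seventeen_mul_twentythree] at h
    exact h
  · rintro _ ⟨q, r, hq, hr, hq7, hqr, rfl⟩
    exact cyclotomicHeight_seven_mul_le hq hr hq7 hqr

theorem theorem3p5 :
    MaxTernaryHeightEq 7 4 ∧
      BeiterConjectureAt 7 ∧ BeiterConjectureMaxAt 7 ∧ CorrectedBeiterConjectureAt 7 := by
  refine ⟨maxTernaryHeightEq_seven_four, fun q r hq hr hq7 hqr => ?_,
    ⟨4, maxTernaryHeightEq_seven_four, by norm_num⟩,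
    ⟨4, maxTernaryHeightEq_seven_four, by norm_num⟩⟩
  have h : (cyclotomicHeight (7 * q * r) : ℚ) ≤ 4 := by
    exact_mod_cast cyclotomicHeight_seven_mul_le hq hr hq7 hqr
  exact h.trans (by norm_num)
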